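/- Consider Dyck words $\sigma=(\sigma(1),\dots,\sigma(N))$ over $\{+,-\}$ (well-formed words, with $+$ the opening and $-$ the closing bracket). The ordered rooted forest $T(\sigma)$ associated with $\sigma$ is defined recursively by $T(\varepsilon)=\varepsilon$ and $T({+}\sigma_1{-}\sigma_2)=(T({+}\sigma_1{-}),T(\sigma_2))$ for Dyck words $\sigma_1,\sigma_2$, where $T({+}\sigma_1{-})$ is the tree in which the children of the root are the roots of the trees of $T(\sigma_1)$; the two displayed symbols $+$ and $-$ are said to be matched to each other in $\sigma$. A tree is binary if every node has at most two children. A re-pairing of $\sigma$ is a sequence of pairs $p=((\ell_1,r_1),\dots,(\ell_{N/2},r_{N/2}))$ with $\sigma(\ell_i)=+$, $\sigma(r_i)=-$ and $\ell_i<r_i$ for all $i$, in which every number from $[1,N]$ occurs in exactly one pair. It is simple if for every $i$ the symbols at positions $\ell_i$ and $r_i$ are matched to each other in $\sigma$. The width of a set of integers is the smallest number of intervals of integers whose union is that set, and the width of $p$ is the maximum over $t\in\{0,\dots,N/2\}$ of the width of the set $\{\ell_1,r_1,\dots,\ell_t,r_t\}$. Let $w(\sigma)$ denote the minimum width of a simple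 re-pairing of $\sigma$. The black-and-white pebble game on an acyclic directed graph $G$ starts with no pebbles on the nodes, and every node carries at most one pebble at any time. The moves are: place a black pebble on a node with no pebble all of whose immediate predecessors carry pebbles; remove a black pebble from any node; place a white pebble on any node with no pebble; remove a white pebble from a node all of whose immediate predecessors carry pebbles. A sequence of moves is successful if it reaches a configuration in which all sinks carry pebbles and no node carries a white pebble. Let $\mathrm{bw}(G)$ be the smallest $k$ such that there is a successful sequence of moves with at most $k$ pebbles on the graph at any time. A rooted tree is regarded as a directed graph with every edge directed from the child to its parent, so its only sink is the root. **Theorem.** There are absolute constants $c,C>0$ such that, for every Dyck word $\sigma$ for which the forest $D=T(\sigma)$ is a (possibly empty) binary tree, simple re-pairings of $\sigma$ and successful sequences of moves on $D$ exist, and $$c\cdot\mathrm{bw}(D)\;\le\; w(\sigma)\;\le\; C\cdot\mathrm{bw}(D).$$ -/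

import Mathlib

/-- Nonempty finite ordered rooted trees: a root with the ordered list of the subtrees rooted at its
children. -/
inductive OrderedTree : Type
  | node (children : List OrderedTree) : OrderedTree

namespace OrderedTree

/-- The subtrees rooted at the children of the root. -/
def children : OrderedTree → List OrderedTree
  | node cs => cs

/-- Every node has at most two children. -/
inductive IsBinary : OrderedTree → Prop
  | node (cs : List OrderedTree) (hlen : cs.length ≤ 2) (hcs : ∀ t ∈ cs, IsBinary t) :
      IsBinary (node cs)

end OrderedTree

/-- Ordered rooted forests: finite sequences of ordered rooted trees. -/
abbrev OrderedForest : Type := List OrderedTree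

namespace OrderedForest

/-- A forest is a tree (possibly the empty tree) if it has at most one component. -/
def IsTree (F : OrderedForest) : Prop := F.length ≤ 1

/-- Every node of the forest has at most two children. -/
def IsBinary (F : OrderedForest) : Prop := ∀ t ∈ F, t.IsBinary

/-- The subtree of the forest rooted at the node with a given address, if there is such a node:
`[i]` is the address of the root of the `i`-th tree, and `a ++ [i]` is the address of the `i`-th
child of the node with address `a` (counting from `0`). -/
def subtreeAt (F : OrderedForest) : List ℕ → Option OrderedTree
  | [] => none
  | [i] => F[i]?
  | i :: j :: a => F[i]?.bind fun t => subtreeAt t.children (j :: a)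

/-- The nodes of a forest, represented by their addresses. -/
abbrev Node (F : OrderedForest) : Type := {a : List ℕ // (subtreeAt F a).isSome}

/-- The forest as a directed graph, with the edges directed from each child to its parent. -/
def graph (F : OrderedForest) : Digraph F.Node where
  Adj u v := ∃ i : ℕ, u.1 = v.1 ++ [i]

end OrderedForest

namespace DyckWord

/-- The ordered rooted forest associated with a Dyck word: the forest of the empty word is empty, and
the forest of `+ σ₁ - σ₂` consists of the tree whose root has the trees of `σ₁` below it, followed
by the trees of `σ₂`. (For a nonempty word `+ σ₁ - σ₂`, Mathlib's `insidePart` is `σ₁` and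
`outsidePart` is `σ₂`.) -/
def forest (σ : DyckWord) : OrderedForest :=
  if h : σ = 0 then []
  else .node (forest σ.insidePart) :: forest σ.outsidePart
termination_by σ.semilength
decreasing_by exacts [semilength_insidePart_lt h, semilength_outsidePart_lt h]

/-- `Matched σ i j`: the symbols of `σ` at positions `i` and `j` (counted from `0`) are matched to
each other. In `+ σ₁ - σ₂`, which is written `σ₁.nest + σ₂`, the displayed `+` and `-` are matched,
and so are the symbols of `σ₁` and of `σ₂` that are matched in these words. -/
inductive Matched : DyckWord → ℕ → ℕ → Prop
  | outer (σ₁ σ₂ : DyckWord) :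
      Matched (σ₁.nest + σ₂) 0 (σ₁.toList.length + 1)
  | left (σ₁ σ₂ : DyckWord) (i j : ℕ) (h : Matched σ₁ i j) :
      Matched (σ₁.nest + σ₂) (i + 1) (j + 1)
  | right (σ₁ σ₂ : DyckWord) (i j : ℕ) (h : Matched σ₂ i j) :
      Matched (σ₁.nest + σ₂) (σ₁.toList.length + 2 + i) (σ₁.toList.length + 2 + j)

/-- `p` is a re-pairing of `σ`: a sequence of `|σ| / 2` pairs of positions (counted from `0`), each
consisting of a plus and of a minus to the right of it, such that every position of `σ` occurs in
exactly one pair. -/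
structure IsRepairing (σ : DyckWord) (p : List (ℕ × ℕ)) : Prop where
  length_eq : p.length = σ.semilength
  signs : ∀ q ∈ p, σ.toList[q.1]? = some DyckStep.U ∧ σ.toList[q.2]? = some DyckStep.D ∧ q.1 < q.2
  exactly_one : ∀ i < σ.toList.length, ∃! k : Fin p.length, (p.get k).1 = i ∨ (p.get k).2 = i

/-- A re-pairing is simple if it always pairs up two symbols that are matched in the word. -/
structure IsSimpleRepairing (σ : DyckWord) (p : List (ℕ × ℕ)) : Prop extends IsRepairing σ p where
  simple : ∀ q ∈ p, σ.Matched q.1 q.2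

end DyckWord

namespace Repairing

/-- The width of a set of integers (here: of positions in a word): the smallest number of intervals
`[a, b]` whose union is the set. -/
noncomputable def setWidth (S : Set ℕ) : ℕ :=
  sInf {k : ℕ | ∃ I : Fin k → ℕ × ℕ, (⋃ m, Set.Icc (I m).1 (I m).2) = S}

/-- The set of positions erased by the first `t` pairs. -/
def erased (p : List (ℕ × ℕ)) (t : ℕ) : Set ℕ :=
  {b : ℕ | ∃ q ∈ p.take t, b = q.1 ∨ b = q.2}

/-- The width of a re-pairing: the maximum over all times of the width of the erased set. -/
noncomputable def width (p : List (ℕ × ℕ)) : ℕ :=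
  (Finset.range (p.length + 1)).sup fun t => setWidth (erased p t)

end Repairing

namespace DyckWord

/-- The set of all widths of simple re-pairings of `σ`. -/
def simpleWidths (σ : DyckWord) : Set ℕ :=
  {w : ℕ | ∃ p : List (ℕ × ℕ), σ.IsSimpleRepairing p ∧ Repairing.width p = w}

/-- The minimum width of a simple re-pairing of `σ`. -/
noncomputable def minSimpleWidth (σ : DyckWord) : ℕ := sInf σ.simpleWidths

end DyckWord

namespace Pebbling

/-- The two colours of pebbles. -/
inductive Pebble : Type
  | black
  | white

/-- A configuration: every node carries no pebble, a black pebble, or a white pebble. -/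
abbrev Config (V : Type*) : Type _ := V → Option Pebble

/-- The number of pebbles in a configuration. (Only finitely many nodes carry pebbles at any time
of the game.) -/
noncomputable def Config.numPebbles {V : Type*} (c : Config V) : ℕ := {v : V | c v ≠ none}.ncard

/-- All immediate predecessors of `v` carry pebbles. -/
def PredecessorsPebbled {V : Type*} (G : Digraph V) (c : Config V) (v : V) : Prop :=
  ∀ u : V, G.Adj u v → c u ≠ none

/-- The moves of the black-and-white pebble game. -/
inductive Move {V : Type*} [DecidableEq V] (G : Digraph V) : Config V → Config V → Prop
  | placeBlack (c : Config V) (v : V) (hv : c v = none) (hpred : PredecessorsPebbled G c v) :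
      Move G c (Function.update c v (some Pebble.black))
  | removeBlack (c : Config V) (v : V) (hv : c v = some Pebble.black) :
      Move G c (Function.update c v none)
  | placeWhite (c : Config V) (v : V) (hv : c v = none) :
      Move G c (Function.update c v (some Pebble.white))
  | removeWhite (c : Config V) (v : V) (hv : c v = some Pebble.white)
      (hpred : PredecessorsPebbled G c v) :
      Move G c (Function.update c v none)

/-- A strategy, given by the sequence of configurations that it goes through: it starts with no
pebbles, and each configuration is obtained from the previous one by a move. -/
structure IsStrategy {V : Type*} [DecidableEq V] (G : Digraph V) (s : List (Config V)) : Prop where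
  start : s.head? = some fun _ => none
  moves : s.IsChain (Move G)

/-- The goal: all sinks carry pebbles and there are no white pebbles. -/
def IsGoal {V : Type*} (G : Digraph V) (c : Config V) : Prop :=
  (∀ v : V, (∀ u : V, ¬ G.Adj v u) → c v ≠ none) ∧ ∀ v : V, c v ≠ some Pebble.white

/-- The numbers of pebbles that are sufficient for a successful strategy. -/
def sufficientPebbles {V : Type*} [DecidableEq V] (G : Digraph V) : Set ℕ :=
  {k : ℕ | ∃ s : List (Config V), IsStrategy G s ∧ (∃ c ∈ s, IsGoal G c) ∧
    ∀ c ∈ s, c.numPebbles ≤ k}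

/-- The black-and-white pebbling number: the minimum number of pebbles sufficient for a successful
strategy. -/
noncomputable def bw {V : Type*} [DecidableEq V] (G : Digraph V) : ℕ := sInf (sufficientPebbles G)

end Pebbling

/-! Each node of the forest owns two symbols of the word, matched to each other, and a simple
re-pairing erases the nodes one at a time. The theorem compares the boundary of a growing set `S` of
nodes, measured by its positions in the word, with its boundary along the edges of the tree. At most
two children per node makes the two comparable up to constants.

From re-pairings to pebbles: call a node done if it and all its children are in `S`. Put white
pebbles on the nodes of `S` that are not done and black ones on the done nodes whose parent is
absent or not done (`stageConfig`). Adding one node to `S` needs only one extra pebble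
(`stageConfig_step`). Every pebbled node is mixed (some child differs from it in membership in `S`),
a child of a mixed node, or the root. Each mixed node forces a change of membership between
consecutive positions at which it is the innermost open node (`exists_change`), so there are at most
twice as many mixed nodes as intervals. This gives `6 * width + 2` pebbles.

From pebbles to re-pairings: a black pebble can be traced back to its placement, and a white one
forward to its removal; at that moment all children are pebbled (`exists_predecessorsPebbled`).
Descending from the root at the final time, this gives each node an interval of times during which
it is pebbled, the intervals of parent and child intersecting (`exists_pebbled_intervals`). Erase
the nodes in the order of the left ends. When an edge joins an erased node to one not yet erased,
the erased end is pebbled at the current threshold time. By `setWidth_positions_le`, `k` pebbles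
then give width at most `6 * k + 1`.

For a nonempty word both quantities are at least 1, which absorbs the additive constants. -/

namespace DyckWord

/-! ### The symbols of a Dyck word, labelled by nodes of its forest -/

open DyckStep

/-- Structural induction on Dyck words: every nonempty word is `+ σ₁ - σ₂`. -/
theorem nestAddInduction {P : DyckWord → Prop} (zero : P 0)
    (nest_add : ∀ σ₁ σ₂ : DyckWord, P σ₁ → P σ₂ → P (σ₁.nest + σ₂)) (σ : DyckWord) : P σ := by
  by_cases h : σ = 0
  · exact h ▸ zero
  · have h₁ := nestAddInduction zero nest_add σ.insidePart
    have h₂ := nestAddInduction zero nest_add σ.outsidePart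
    exact nest_insidePart_add_outsidePart h ▸ nest_add _ _ h₁ h₂
termination_by σ.semilength
decreasing_by exacts [semilength_insidePart_lt h, semilength_outsidePart_lt h]

lemma nest_add_ne_zero (σ₁ σ₂ : DyckWord) : σ₁.nest + σ₂ ≠ 0 := by
  simp [← toList_ne_nil, nest]

lemma insidePart_nest_add (σ₁ σ₂ : DyckWord) : (σ₁.nest + σ₂).insidePart = σ₁ := by
  rw [insidePart_add nest_ne_zero, insidePart_nest]

lemma outsidePart_nest_add (σ₁ σ₂ : DyckWord) : (σ₁.nest + σ₂).outsidePart = σ₂ := by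
  rw [outsidePart_add nest_ne_zero, outsidePart_nest, zero_add]

lemma toList_nest_add (σ₁ σ₂ : DyckWord) :
    (σ₁.nest + σ₂).toList = U :: (σ₁.toList ++ D :: σ₂.toList) := by
  change σ₁.nest.toList ++ σ₂.toList = _
  simp [nest]

@[simp] lemma forest_zero : forest 0 = [] := by
  rw [forest]; simp

lemma forest_nest_add (σ₁ σ₂ : DyckWord) :
    (σ₁.nest + σ₂).forest = .node σ₁.forest :: σ₂.forest := by
  rw [forest, dif_neg (nest_add_ne_zero σ₁ σ₂), insidePart_nest_add, outsidePart_nest_add]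

/-- The symbols of a Dyck word, each with the address of the node of the forest that it
delimits. The trees of the forest get the addresses `b ++ [k]`, `b ++ [k + 1]`, and so on. -/
def labels (σ : DyckWord) (b : List ℕ) (k : ℕ) : List (DyckStep × List ℕ) :=
  if h : σ = 0 then []
  else (U, b ++ [k]) :: (labels σ.insidePart (b ++ [k]) 0 ++
    (D, b ++ [k]) :: labels σ.outsidePart b (k + 1))
termination_by σ.semilength
decreasing_by exacts [semilength_insidePart_lt h, semilength_outsidePart_lt h]

@[simp] lemma labels_zero (b : List ℕ) (k : ℕ) : labels 0 b k = [] := by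
  rw [labels]; simp

lemma labels_nest_add (σ₁ σ₂ : DyckWord) (b : List ℕ) (k : ℕ) :
    (σ₁.nest + σ₂).labels b k = (U, b ++ [k]) :: (σ₁.labels (b ++ [k]) 0 ++
      (D, b ++ [k]) :: σ₂.labels b (k + 1)) := by
  rw [labels, dif_neg (nest_add_ne_zero σ₁ σ₂), insidePart_nest_add, outsidePart_nest_add]

lemma map_fst_labels (σ : DyckWord) (b : List ℕ) (k : ℕ) :
    (σ.labels b k).map Prod.fst = σ.toList := by
  induction σ using nestAddInduction generalizing b k with
  | zero => simp; rfl
  | nest_add σ₁ σ₂ ih₁ ih₂ => simp [labels_nest_add, toList_nest_add, ih₁, ih₂]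

lemma length_labels (σ : DyckWord) (b : List ℕ) (k : ℕ) :
    (σ.labels b k).length = σ.toList.length := by
  rw [← map_fst_labels σ b k, List.length_map]

/-- The condition does not involve `x.1`, so every node owns both an opening and a closing symbol.
The offset `k` is there because the recursion on the outside part shifts the numbering of the trees.
-/
lemma mem_labels {σ : DyckWord} {b : List ℕ} {k : ℕ} {x : DyckStep × List ℕ} :
    x ∈ σ.labels b k ↔ ∃ (j : ℕ) (a : List ℕ), x.2 = b ++ (k + j) :: a ∧
      (OrderedForest.subtreeAt σ.forest (j :: a)).isSome := by
  induction σ using nestAddInduction generalizing b k with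
  | zero =>
    simp only [labels_zero, List.not_mem_nil, forest_zero, false_iff, not_exists, not_and]
    intro j a _
    cases a <;> simp [OrderedForest.subtreeAt]
  | nest_add σ₁ σ₂ ih₁ ih₂ =>
    obtain ⟨s, v⟩ := x
    rw [labels_nest_add, forest_nest_add]
    simp only [List.mem_cons, List.mem_append, ih₁, ih₂, Prod.mk.injEq]
    constructor
    · rintro (⟨-, rfl⟩ | ⟨j, a, rfl, h⟩ | ⟨-, rfl⟩ | ⟨j, a, rfl, h⟩)
      · exact ⟨0, [], by simp, by simp [OrderedForest.subtreeAt]⟩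
      · exact ⟨0, j :: a, by simp, by simpa [OrderedForest.subtreeAt, OrderedTree.children] using h⟩
      · exact ⟨0, [], by simp, by simp [OrderedForest.subtreeAt]⟩
      · refine ⟨j + 1, a, by simp; omega, ?_⟩
        cases a <;> simpa [OrderedForest.subtreeAt] using h
    · rintro ⟨j, a, rfl, h⟩
      rcases j with _ | j
      · rcases a with _ | ⟨i, a⟩
        · cases s <;> simp
        · right; left
          exact ⟨i, a, by simp, by simpa [OrderedForest.subtreeAt, OrderedTree.children] using h⟩
      · right; right; right
        refine ⟨j, a, by simp; omega, ?_⟩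
        cases a <;> simpa [OrderedForest.subtreeAt] using h

lemma nodup_labels (σ : DyckWord) (b : List ℕ) (k : ℕ) : (σ.labels b k).Nodup := by
  induction σ using nestAddInduction generalizing b k with
  | zero => simp
  | nest_add σ₁ σ₂ ih₁ ih₂ =>
    have inner : ∀ s v, (s, v) ∈ σ₁.labels (b ++ [k]) 0 → ∃ j a, v = b ++ k :: j :: a := by
      intro s v h
      obtain ⟨j, a, h, -⟩ := mem_labels.1 h
      exact ⟨0 + j, a, by simpa using h⟩
    have outer : ∀ s v, (s, v) ∈ σ₂.labels b (k + 1) → ∃ j a, v = b ++ (k + 1 + j) :: a := by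
      intro s v h
      obtain ⟨j, a, h, -⟩ := mem_labels.1 h
      exact ⟨j, a, h⟩
    rw [labels_nest_add, List.nodup_cons, List.nodup_append, List.nodup_cons]
    refine ⟨?_, ih₁ _ _, ⟨?_, ih₂ _ _⟩, ?_⟩
    · intro h
      rcases List.mem_append.1 h with h | h
      · obtain ⟨j, a, h⟩ := inner _ _ h
        simp at h
      · rcases List.mem_cons.1 h with h | h
        · simp at h
        · obtain ⟨j, a, h⟩ := outer _ _ h
          simp at h; omega
    · intro h
      obtain ⟨j, a, h⟩ := outer _ _ h
      simp at h; omega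
    · rintro ⟨s, v⟩ h₁ ⟨s', v'⟩ h₂ heq
      obtain ⟨rfl, rfl⟩ := Prod.mk.inj heq
      obtain ⟨j, a, rfl⟩ := inner _ _ h₁
      rcases List.mem_cons.1 h₂ with h | h
      · simp at h
      · obtain ⟨j, a, h⟩ := outer _ _ h
        simp at h; omega

/-- The possible pairs of consecutive labels. -/
inductive NextLabel : DyckStep × List ℕ → DyckStep × List ℕ → Prop
  | down (v : List ℕ) : NextLabel (U, v) (U, v ++ [0])
  | leaf (v : List ℕ) : NextLabel (U, v) (D, v)
  | sibling (w : List ℕ) (j : ℕ) : NextLabel (D, w ++ [j]) (U, w ++ [j + 1])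
  | up (w : List ℕ) (j : ℕ) : NextLabel (D, w ++ [j]) (D, w)

lemma head?_labels {σ : DyckWord} {b : List ℕ} {k : ℕ} {x : DyckStep × List ℕ}
    (h : x ∈ (σ.labels b k).head?) : x = (U, b ++ [k]) := by
  induction σ using nestAddInduction with
  | zero => simp at h
  | nest_add σ₁ σ₂ _ _ => simpa [labels_nest_add, eq_comm] using h

lemma getLast?_labels {σ : DyckWord} {b : List ℕ} {k : ℕ} {x : DyckStep × List ℕ}
    (h : x ∈ (σ.labels b k).getLast?) : ∃ j, x = (D, b ++ [j]) := by
  induction σ using nestAddInduction generalizing k with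
  | zero => simp at h
  | nest_add σ₁ σ₂ _ ih =>
    rw [labels_nest_add, ← List.cons_append, List.getLast?_append_cons] at h
    rcases hl : σ₂.labels b (k + 1) with _ | ⟨y, l⟩
    · exact ⟨k, by simpa [hl, eq_comm] using h⟩
    · rw [hl, List.getLast?_cons_cons, ← hl] at h
      exact ih h

/-- Consecutive symbols belong to the same node, to a parent and child, or to adjacent siblings.
This local rule is what links intervals of positions to edges of the forest. -/
lemma isChain_labels (σ : DyckWord) (b : List ℕ) (k : ℕ) :
    (σ.labels b k).IsChain NextLabel := by
  induction σ using nestAddInduction generalizing b k with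
  | zero => simp
  | nest_add σ₁ σ₂ ih₁ ih₂ =>
    rw [labels_nest_add, List.isChain_cons, List.isChain_append, List.isChain_cons]
    refine ⟨?_, ih₁ _ _, ⟨?_, ih₂ _ _⟩, ?_⟩
    · intro y hy
      rcases hl : σ₁.labels (b ++ [k]) 0 with _ | ⟨z, l⟩
      · rw [hl] at hy
        obtain rfl : (D, b ++ [k]) = y := by simpa using hy
        exact .leaf _
      · have hz : z = (U, b ++ [k] ++ [0]) := head?_labels (σ := σ₁) (by simp [hl])
        rw [hl] at hy
        obtain rfl : z = y := by simpa using hy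
        exact hz ▸ .down _
    · intro y hy
      rw [head?_labels hy]
      exact .sibling _ _
    · intro x hx y hy
      obtain ⟨j, rfl⟩ := getLast?_labels hx
      obtain rfl : (D, b ++ [k]) = y := by simpa using hy
      exact .up _ _

lemma Matched.lt {σ : DyckWord} {i j : ℕ} (h : σ.Matched i j) : i < j := by
  induction h <;> omega

lemma getElem?_labels_inside {σ₁ σ₂ : DyckWord} {b : List ℕ} {k i : ℕ}
    {x : DyckStep × List ℕ} (h : (σ₁.labels (b ++ [k]) 0)[i]? = some x) :
    ((σ₁.nest + σ₂).labels b k)[i + 1]? = some x := by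
  rw [labels_nest_add, List.getElem?_cons_succ,
    List.getElem?_append_left (List.getElem?_eq_some_iff.1 h).1, h]

lemma getElem?_labels_close (σ₁ σ₂ : DyckWord) (b : List ℕ) (k : ℕ) :
    ((σ₁.nest + σ₂).labels b k)[σ₁.toList.length + 1]? = some (D, b ++ [k]) := by
  rw [labels_nest_add, List.getElem?_cons_succ,
    List.getElem?_append_right (by rw [length_labels])]
  simp [length_labels]

lemma getElem?_labels_outside (σ₁ σ₂ : DyckWord) (b : List ℕ) (k i : ℕ) :
    ((σ₁.nest + σ₂).labels b k)[σ₁.toList.length + 2 + i]? = (σ₂.labels b (k + 1))[i]? := by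
  rw [labels_nest_add,
    show σ₁.toList.length + 2 + i = σ₁.toList.length + (i + 1) + 1 by omega,
    List.getElem?_cons_succ, List.getElem?_append_right (by rw [length_labels]; omega),
    length_labels, Nat.add_sub_cancel_left, List.getElem?_cons_succ]

lemma getElem?_labels_inj {σ : DyckWord} {b : List ℕ} {k i j : ℕ} {x : DyckStep × List ℕ}
    (hi : (σ.labels b k)[i]? = some x) (hj : (σ.labels b k)[j]? = some x) : i = j :=
  (List.getElem?_inj (List.getElem?_eq_some_iff.1 hi).1 (nodup_labels σ b k)).1 (hi.trans hj.symm)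

lemma Matched.labels {σ : DyckWord} {i j : ℕ} (h : σ.Matched i j) (b : List ℕ) (k : ℕ) :
    ∃ v, (σ.labels b k)[i]? = some (U, v) ∧ (σ.labels b k)[j]? = some (D, v) := by
  induction h generalizing b k with
  | outer σ₁ σ₂ => exact ⟨b ++ [k], by simp [labels_nest_add], getElem?_labels_close ..⟩
  | left σ₁ σ₂ i j h ih =>
    obtain ⟨v, hi, hj⟩ := ih (b ++ [k]) 0
    exact ⟨v, getElem?_labels_inside hi, getElem?_labels_inside hj⟩
  | right σ₁ σ₂ i j h ih =>
    obtain ⟨v, hi, hj⟩ := ih b (k + 1)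
    exact ⟨v, by rw [getElem?_labels_outside, hi], by rw [getElem?_labels_outside, hj]⟩

lemma exists_matched {σ : DyckWord} {b : List ℕ} {k : ℕ} {x : DyckStep × List ℕ}
    (hx : x ∈ σ.labels b k) : ∃ i j, σ.Matched i j ∧
      (σ.labels b k)[i]? = some (U, x.2) ∧ (σ.labels b k)[j]? = some (D, x.2) := by
  induction σ using nestAddInduction generalizing b k with
  | zero => simp at hx
  | nest_add σ₁ σ₂ ih₁ ih₂ =>
    have hroot : ∃ i j, (σ₁.nest + σ₂).Matched i j ∧
        ((σ₁.nest + σ₂).labels b k)[i]? = some (U, b ++ [k]) ∧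
        ((σ₁.nest + σ₂).labels b k)[j]? = some (D, b ++ [k]) :=
      ⟨_, _, .outer σ₁ σ₂, by simp [labels_nest_add], getElem?_labels_close ..⟩
    rw [labels_nest_add] at hx
    rcases List.mem_cons.1 hx with rfl | h
    · exact hroot
    rcases List.mem_append.1 h with h | h
    · obtain ⟨i, j, hm, hi, hj⟩ := ih₁ h
      exact ⟨_, _, .left σ₁ σ₂ i j hm, getElem?_labels_inside hi, getElem?_labels_inside hj⟩
    rcases List.mem_cons.1 h with rfl | h
    · exact hroot
    · obtain ⟨i, j, hm, hi, hj⟩ := ih₂ h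
      exact ⟨_, _, .right σ₁ σ₂ i j hm, by rw [getElem?_labels_outside, hi],
        by rw [getElem?_labels_outside, hj]⟩

end DyckWord

/-! ### Addresses, parents and children in a forest -/

namespace OrderedForest

@[simp] lemma subtreeAt_nil (F : OrderedForest) : F.subtreeAt [] = none := rfl

lemma subtreeAt_append_singleton (F : OrderedForest) {w : List ℕ} (hw : w ≠ []) (i : ℕ) :
    F.subtreeAt (w ++ [i]) = (F.subtreeAt w).bind fun t => t.children[i]? := by
  induction w generalizing F with
  | nil => exact absurd rfl hw
  | cons j w ih =>
    rcases w with _ | ⟨l, w⟩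
    · simp [subtreeAt]
    · simp only [List.cons_append, subtreeAt, Option.bind_assoc]
      congr 1
      funext t
      exact ih t.children (by simp)

lemma IsBinary.subtreeAt {F : OrderedForest} (hF : F.IsBinary) {a : List ℕ} {t : OrderedTree}
    (h : F.subtreeAt a = some t) : t.IsBinary := by
  induction a using List.reverseRecOn generalizing t with
  | nil => simp at h
  | append_singleton w i ih =>
    rcases eq_or_ne w [] with rfl | hw
    · exact hF t (List.mem_of_getElem? (i := i) h)
    · rw [subtreeAt_append_singleton F hw] at h
      obtain ⟨t', ht', hi⟩ := Option.bind_eq_some_iff.1 h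
      obtain ⟨cs, -, hcs⟩ := ih ht'
      exact hcs t (List.mem_of_getElem? hi)

lemma IsBinary.lt_two {F : OrderedForest} (hF : F.IsBinary) {w : List ℕ} (hw : w ≠ []) {i : ℕ}
    (h : (F.subtreeAt (w ++ [i])).isSome) : i < 2 := by
  rw [subtreeAt_append_singleton F hw] at h
  obtain ⟨t, h⟩ := Option.isSome_iff_exists.1 h
  obtain ⟨t', ht', hi⟩ := Option.bind_eq_some_iff.1 h
  obtain ⟨cs, hlen, -⟩ := hF.subtreeAt ht'
  exact (List.getElem?_eq_some_iff.1 hi).1.trans_le hlen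

lemma isSome_subtreeAt_of_append {F : OrderedForest} {w : List ℕ} (hw : w ≠ []) {i : ℕ}
    (h : (F.subtreeAt (w ++ [i])).isSome) : (F.subtreeAt w).isSome := by
  rw [subtreeAt_append_singleton F hw] at h
  obtain ⟨t, h⟩ := Option.isSome_iff_exists.1 h
  obtain ⟨t', ht', -⟩ := Option.bind_eq_some_iff.1 h
  simp [ht']

lemma IsTree.eq_zero {F : OrderedForest} (hF : F.IsTree) {i : ℕ}
    (h : (F.subtreeAt [i]).isSome) : i = 0 := by
  obtain ⟨t, h⟩ := Option.isSome_iff_exists.1 h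
  have := (List.getElem?_eq_some_iff.1 (show F[i]? = some t from h)).1
  have : F.length ≤ 1 := hF
  omega

lemma Node.ne_nil {F : OrderedForest} (v : F.Node) : v.1 ≠ [] := by
  intro h
  have := v.2
  simp [h] at this

/-- Every node is the root of one of the trees or has a parent. -/
lemma Node.root_or_adj {F : OrderedForest} (v : F.Node) :
    (∃ i, v.1 = [i]) ∨ ∃ w : F.Node, F.graph.Adj v w := by
  obtain ⟨a, ha⟩ := v
  rcases List.eq_nil_or_concat a with rfl | ⟨w, i, rfl⟩
  · simp at ha
  · simp only [List.concat_eq_append] at ha ⊢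
    rcases eq_or_ne w [] with rfl | hw
    · exact .inl ⟨i, rfl⟩
    · exact .inr ⟨⟨w, isSome_subtreeAt_of_append hw ha⟩, i, rfl⟩

lemma graph_adj_unique {F : OrderedForest} {u v w : F.Node} (hv : F.graph.Adj u v)
    (hw : F.graph.Adj u w) : v = w := by
  obtain ⟨i, hi⟩ := hv
  obtain ⟨j, hj⟩ := hw
  exact Subtype.ext (List.append_inj_left' (hi.symm.trans hj) rfl)

lemma graph_irrefl {F : OrderedForest} (v : F.Node) : ¬ F.graph.Adj v v := by
  rintro ⟨i, hi⟩
  simpa using congrArg List.length hi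

end OrderedForest

/-! ### Labels of the whole word and finiteness of the node set -/

namespace DyckWord

open DyckStep

lemma mem_labels_root {σ : DyckWord} {x : DyckStep × List ℕ} :
    x ∈ σ.labels [] 0 ↔ (σ.forest.subtreeAt x.2).isSome := by
  rw [mem_labels]
  constructor
  · rintro ⟨j, a, h, hs⟩
    simpa [h] using hs
  · intro h
    rcases hx : x.2 with _ | ⟨j, a⟩
    · simp [hx] at h
    · exact ⟨j, a, by simp, hx ▸ h⟩

instance finite_node (σ : DyckWord) : Finite σ.forest.Node := by
  refine Set.Finite.to_subtype (Set.Finite.subset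
    ((σ.labels [] 0).map Prod.snd).toFinset.finite_toSet fun a ha => ?_)
  simp only [List.coe_toFinset, Set.mem_ofPred_eq, List.mem_map]
  exact ⟨(U, a), mem_labels_root.2 ha, rfl⟩

end DyckWord

/-! ### The width of a finite set counted by its boundary positions -/

namespace Repairing

lemma exists_intervals {S : Set ℕ} (hS : S.Finite) :
    ∃ I : Fin {i ∈ S | i + 1 ∉ S}.ncard → ℕ × ℕ, (⋃ m, Set.Icc (I m).1 (I m).2) = S := by
  classical
  set R := {i ∈ S | i + 1 ∉ S} with hR
  have hRfin : R.Finite := hS.subset (Set.sep_subset _ _)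
  have := hRfin.to_subtype
  have e : Fin R.ncard ≃ R := (Finite.equivFinOfCardEq rfl).symm
  have hstart : ∀ i : R, ∃ a, Set.Icc a i.1 ⊆ S := fun i => ⟨i.1, by simpa using i.2.1⟩
  -- One interval per right end `i` of a maximal run, starting at the least `a` with `Set.Icc a i ⊆
  -- S`. Finiteness of `S` ensures that every run has a right end.
  refine ⟨fun m => (Nat.find (hstart (e m)), (e m).1), Set.Subset.antisymm ?_ ?_⟩
  · exact Set.iUnion_subset fun m => Nat.find_spec (hstart (e m))
  · intro x hx
    have hend : ∃ i, x ≤ i ∧ i + 1 ∉ S := by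
      obtain ⟨M, hM⟩ := hS.bddAbove
      exact ⟨max x M, le_max_left _ _, fun h => by
        have := hM h
        have := le_max_right x M
        omega⟩
    have hsub : Set.Icc x (Nat.find hend) ⊆ S := by
      intro y hy
      rcases hy.1.eq_or_lt with rfl | hlt
      · exact hx
      · have := Nat.find_min hend (m := y - 1) (by have := hy.2; omega)
        rw [Nat.sub_add_cancel (by omega)] at this
        by_contra hyS
        exact this ⟨by omega, hyS⟩
    have hspec := Nat.find_spec hend
    have hmem : Nat.find hend ∈ R := ⟨hsub ⟨hspec.1, le_rfl⟩, hspec.2⟩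
    refine Set.mem_iUnion.2 ⟨e.symm ⟨_, hmem⟩, ?_⟩
    simp only [Equiv.apply_symm_apply]
    exact ⟨Nat.find_min' _ hsub, hspec.1⟩

lemma setWidth_le_ncard {S : Set ℕ} (hS : S.Finite) :
    setWidth S ≤ {i ∈ S | i + 1 ∉ S}.ncard :=
  Nat.sInf_le (exists_intervals hS)

lemma exists_intervals_setWidth {S : Set ℕ} (hS : S.Finite) :
    ∃ I : Fin (setWidth S) → ℕ × ℕ, (⋃ m, Set.Icc (I m).1 (I m).2) = S :=
  Nat.sInf_mem (s := {k : ℕ | ∃ I : Fin k → ℕ × ℕ, (⋃ m, Set.Icc (I m).1 (I m).2) = S})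
    ⟨_, exists_intervals hS⟩

/-- An interval of the cover containing an exit must end there, so the right ends of the intervals
include all exits. -/
lemma ncard_exits_le_setWidth {S : Set ℕ} (hS : S.Finite) :
    {i | i ∈ S ∧ i + 1 ∉ S}.ncard ≤ setWidth S := by
  obtain ⟨I, hI⟩ := exists_intervals_setWidth hS
  have : {i | i ∈ S ∧ i + 1 ∉ S} ⊆ Set.range fun m => (I m).2 := by
    rintro i ⟨hi, hi'⟩
    rw [← hI] at hi hi'
    obtain ⟨m, hm⟩ := Set.mem_iUnion.1 hi
    have h₁ := hm.1
    have h₂ := hm.2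
    have : ¬ i + 1 ≤ (I m).2 := fun h => hi' (Set.mem_iUnion.2 ⟨m, by omega, h⟩)
    refine ⟨m, ?_⟩
    change (I m).2 = i
    omega
  calc _ ≤ (Set.range fun m => (I m).2).ncard := Set.ncard_le_ncard this (Set.finite_range _)
    _ ≤ setWidth S := by
      rw [← Set.image_univ]
      simpa using Set.ncard_image_le (f := fun m => (I m).2) (Set.finite_univ (α := Fin (setWidth S)))

lemma ncard_entries_le_setWidth {S : Set ℕ} (hS : S.Finite) :
    {i | i ∉ S ∧ i + 1 ∈ S}.ncard ≤ setWidth S := by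
  obtain ⟨I, hI⟩ := exists_intervals_setWidth hS
  have : {i | i ∉ S ∧ i + 1 ∈ S} ⊆ Set.range fun m => (I m).1 - 1 := by
    rintro i ⟨hi, hi'⟩
    rw [← hI] at hi hi'
    obtain ⟨m, hm⟩ := Set.mem_iUnion.1 hi'
    refine ⟨m, ?_⟩
    have h₁ := hm.1
    have h₂ := hm.2
    have : ¬ (I m).1 ≤ i := fun h => hi (Set.mem_iUnion.2 ⟨m, h, by omega⟩)
    change (I m).1 - 1 = i
    omega
  calc _ ≤ (Set.range fun m => (I m).1 - 1).ncard := Set.ncard_le_ncard this (Set.finite_range _)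
    _ ≤ setWidth S := by
      rw [← Set.image_univ]
      simpa using Set.ncard_image_le (f := fun m => (I m).1 - 1)
        (Set.finite_univ (α := Fin (setWidth S)))

lemma finite_erased (p : List (ℕ × ℕ)) (t : ℕ) : (erased p t).Finite := by
  refine (((p.take t).map Prod.fst).toFinset ∪
    ((p.take t).map Prod.snd).toFinset).finite_toSet.subset ?_
  rintro b ⟨q, hq, rfl | rfl⟩ <;> simp only [Finset.coe_union, List.coe_toFinset, List.mem_map]
  · exact .inl ⟨q, hq, rfl⟩
  · exact .inr ⟨q, hq, rfl⟩

lemma setWidth_erased_le_width (p : List (ℕ × ℕ)) {t : ℕ} (ht : t ≤ p.length) :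
    setWidth (erased p t) ≤ width p :=
  Finset.le_sup (f := fun t => setWidth (erased p t)) (Finset.mem_range.2 (by omega))

end Repairing

/-! ### Strategies that follow a growing set of nodes -/

namespace Pebbling

open Relation

variable {V : Type*} {G : Digraph V}

/-- One move, after which there are at most `k` pebbles on the graph. -/
def BoundedMove [DecidableEq V] (G : Digraph V) (k : ℕ) (c c' : Config V) : Prop :=
  Move G c c' ∧ c'.numPebbles ≤ k

lemma mem_sufficientPebbles_of_reflTransGen [DecidableEq V] {k : ℕ} {c : Config V}
    (h : ReflTransGen (BoundedMove G k) (fun _ => none) c) (hc : IsGoal G c) :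
    k ∈ sufficientPebbles G := by
  obtain ⟨l, hl, hlast⟩ := List.exists_isChain_cons_of_relationReflTransGen h
  refine ⟨(fun _ => none) :: l, ⟨rfl, hl.imp fun _ _ h => h.1⟩,
    ⟨c, hlast ▸ List.getLast_mem _, hc⟩, ?_⟩
  have hbound : ∀ (l : List (Config V)) (a : Config V), a.numPebbles ≤ k →
      (a :: l).IsChain (BoundedMove G k) → ∀ c ∈ a :: l, c.numPebbles ≤ k := by
    intro l
    induction l with
    | nil => simp +contextual
    | cons b l ih =>
      intro a ha hchain c hc
      rw [List.isChain_cons_cons] at hchain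
      rcases List.mem_cons.1 hc with rfl | hc
      · exact ha
      · exact ih b hchain.1.2 hchain.2 c hc
  exact hbound l _ (by simp [Config.numPebbles]) hl

lemma Config.numPebbles_mono [Finite V] {c c' : Config V} (h : ∀ u, c u ≠ none → c' u ≠ none) :
    c.numPebbles ≤ c'.numPebbles :=
  Set.ncard_le_ncard h (Set.toFinite _)

/-- Black pebbles can be removed. -/
lemma reflTransGen_removeBlack [DecidableEq V] [Finite V] {k : ℕ} {c c' : Config V} (hk : c.numPebbles ≤ k)
    (h : ∀ u, c' u = c u ∨ c u = some .black ∧ c' u = none) :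
    ReflTransGen (BoundedMove G k) c c' := by
  obtain ⟨n, hn⟩ : ∃ n, {u | c' u ≠ c u}.ncard = n := ⟨_, rfl⟩
  induction n generalizing c with
  | zero =>
    rw [Set.ncard_eq_zero (Set.toFinite _)] at hn
    have : c = c' := by
      funext u
      by_contra hu
      have : u ∈ {u | c' u ≠ c u} := fun h => hu h.symm
      rw [hn] at this
      exact this
    rw [this]
  | succ n ih =>
    obtain ⟨v, hv⟩ : {u | c' u ≠ c u}.Nonempty := by
      rw [← Set.ncard_pos (Set.toFinite _)]; omega
    obtain ⟨hb, hnone⟩ := (h v).resolve_left hv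
    have hle : Config.numPebbles (Function.update c v none) ≤ k := by
      refine (Config.numPebbles_mono fun u hu => ?_).trans hk
      rcases eq_or_ne u v with rfl | huv
      · simp at hu
      · simpa [huv] using hu
    refine .head ⟨.removeBlack c v hb, hle⟩ (ih hle (fun u => ?_) ?_)
    · rcases eq_or_ne u v with rfl | huv
      · simp [hnone]
      · simpa [huv] using h u
    · have : {u | c' u ≠ Function.update c v none u} = {u | c' u ≠ c u} \ {v} := by
        ext u
        simp only [Set.mem_ofPred_eq, Set.mem_sdiff, Set.mem_singleton_iff]
        rcases eq_or_ne u v with rfl | huv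
        · simp [hnone]
        · simp [huv]
      rw [this, Set.ncard_sdiff_singleton_of_mem hv, hn]
      rfl

/-- The node and all its immediate predecessors belong to `S`. -/
def Done (G : Digraph V) (S : Set V) (v : V) : Prop := v ∈ S ∧ ∀ u, G.Adj u v → u ∈ S

lemma Done.mono {S S' : Set V} (h : S ⊆ S') {v : V} (hv : Done G S v) : Done G S' v :=
  ⟨h hv.1, fun u hu => h (hv.2 u hu)⟩

open Classical in
/-- The configuration that is reached when the nodes from `S` have been dealt with. -/
noncomputable def stageConfig (G : Digraph V) (S : Set V) : Config V := fun u =>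
  if u ∉ S then none
  else if ¬ Done G S u then some .white
  else if ∃ w, G.Adj u w ∧ Done G S w then none
  else some .black

lemma stageConfig_of_notMem {S : Set V} {u : V} (h : u ∉ S) : stageConfig G S u = none := by
  simp [stageConfig, h]

lemma stageConfig_of_not_done {S : Set V} {u : V} (h : u ∈ S) (hd : ¬ Done G S u) :
    stageConfig G S u = some .white := by
  simp [stageConfig, h, hd]

lemma stageConfig_of_done_parent {S : Set V} {u w : V} (hd : Done G S u) (hw : G.Adj u w)
    (hdw : Done G S w) : stageConfig G S u = none := by
  have : ∃ w, G.Adj u w ∧ Done G S w := ⟨w, hw, hdw⟩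
  simp [stageConfig, hd.1, hd, this]

lemma stageConfig_of_done {S : Set V} {u : V} (hd : Done G S u)
    (h : ∀ w, G.Adj u w → ¬ Done G S w) : stageConfig G S u = some .black := by
  have : ¬ ∃ w, G.Adj u w ∧ Done G S w := fun ⟨w, hw, hdw⟩ => h w hw hdw
  simp [stageConfig, hd.1, hd, this]

lemma stageConfig_eq_black_or_none {S : Set V} {u : V} (hd : Done G S u) :
    stageConfig G S u = some .black ∨ stageConfig G S u = none := by
  by_cases h : ∃ w, G.Adj u w ∧ Done G S w
  · exact .inr (stageConfig_of_done_parent hd h.choose_spec.1 h.choose_spec.2)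
  · exact .inl (stageConfig_of_done hd fun w hw hdw => h ⟨w, hw, hdw⟩)

/-- A pebble on a node of `S` is dropped only when its unique successor is done. This is what makes
the predecessors available when the pebble on `x` is placed or recoloured. -/
lemma stageConfig_ne_none (huniq : ∀ u v w, G.Adj u v → G.Adj u w → v = w) {S : Set V} {u x : V}
    (hu : u ∈ S) (hux : G.Adj u x) (hx : ¬ Done G S x) : stageConfig G S u ≠ none := by
  by_cases hd : Done G S u
  · rw [stageConfig_of_done hd fun w hw => huniq u x w hux hw ▸ hx]
    simp
  · rw [stageConfig_of_not_done hu hd]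
    simp

/-- Apart from `v`, only a successor of `v` can become done. At every other node the colour
persists, or a black pebble disappears because the successor has become done. -/
lemma stageConfig_insert {S : Set V} {u v : V} (huv : u ≠ v)
    (h : ¬ (G.Adj v u ∧ Done G (insert v S) u)) :
    stageConfig G (insert v S) u = stageConfig G S u ∨
      stageConfig G S u = some .black ∧ stageConfig G (insert v S) u = none := by
  by_cases hu : u ∈ S
  · by_cases hd : Done G S u
    · have hd' := hd.mono (Set.subset_insert v S)
      by_cases hw : ∃ w, G.Adj u w ∧ Done G S w
      · obtain ⟨w, hw, hdw⟩ := hw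
        rw [stageConfig_of_done_parent hd hw hdw,
          stageConfig_of_done_parent hd' hw (hdw.mono (Set.subset_insert v S))]
        exact .inl rfl
      · rw [stageConfig_of_done hd fun w hw' hdw => hw ⟨w, hw', hdw⟩]
        exact (stageConfig_eq_black_or_none hd').imp_right fun h => ⟨rfl, h⟩
    · have hd' : ¬ Done G (insert v S) u := fun hd' => hd ⟨hu, fun x hx =>
        (hd'.2 x hx).resolve_left fun hxv => h ⟨hxv ▸ hx, hd'⟩⟩
      rw [stageConfig_of_not_done hu hd, stageConfig_of_not_done (.inr hu) hd']
      exact .inl rfl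
  · rw [stageConfig_of_notMem hu, stageConfig_of_notMem (by simp [huv, hu])]
    exact .inl rfl

/-- Place a pebble on `v`, turn the white pebble of its successor black if that node has become
done, and remove the black pebbles no longer needed. Only the first placement raises the number of
pebbles. -/
lemma stageConfig_step [DecidableEq V] [Finite V]
    (huniq : ∀ u v w, G.Adj u v → G.Adj u w → v = w) (hirr : ∀ v, ¬ G.Adj v v)
    {S : Set V} {v : V} {k : ℕ} (hk : (stageConfig G S).numPebbles + 1 ≤ k) :
    ReflTransGen (BoundedMove G k) (stageConfig G S) (stageConfig G (insert v S)) := by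
  classical
  by_cases hv : v ∈ S
  · rw [Set.insert_eq_of_mem hv]
  set S' := insert v S with hS'
  set c₁ : Config V := Function.update (stageConfig G S) v
    (some (if Done G S' v then .black else .white)) with hc₁
  have hc₁v : c₁ v = some (if Done G S' v then .black else .white) := by simp [hc₁]
  have hc₁u : ∀ u, u ≠ v → c₁ u = stageConfig G S u := fun u hu => by simp [hc₁, hu]
  have hnum : c₁.numPebbles ≤ k := by
    refine le_trans ?_ ((Set.ncard_insert_le v {u | stageConfig G S u ≠ none}).trans hk)
    refine Set.ncard_le_ncard (fun u hu => ?_) (Set.toFinite _)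
    rcases eq_or_ne u v with rfl | huv
    · exact Set.mem_insert _ _
    · exact Set.mem_insert_of_mem _ (by simpa [hc₁u u huv] using hu)
  have hvdone : ¬ Done G S v := fun h => hv h.1
  have hmove₁ : BoundedMove G k (stageConfig G S) c₁ := by
    refine ⟨?_, hnum⟩
    by_cases hd : Done G S' v
    · rw [hc₁, if_pos hd]
      refine .placeBlack _ v (stageConfig_of_notMem hv) fun u hu => ?_
      have huS : u ∈ S := (hd.2 u hu).resolve_left fun h => hirr v (h ▸ hu)
      exact stageConfig_ne_none huniq huS hu hvdone
    · rw [hc₁, if_neg hd]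
      exact .placeWhite _ v (stageConfig_of_notMem hv)
  have hfinal_v : stageConfig G S' v = c₁ v ∨
      c₁ v = some .black ∧ stageConfig G S' v = none := by
    rw [hc₁v]
    by_cases hd : Done G S' v
    · simpa [hd] using stageConfig_eq_black_or_none hd
    · simpa [hd] using stageConfig_of_not_done (Set.mem_insert v S) hd
  refine .head hmove₁ ?_
  by_cases hw : ∃ w, G.Adj v w ∧ Done G S' w
  · obtain ⟨w, hvw, hdw⟩ := hw
    have hwv : w ≠ v := fun h => hirr v (h ▸ hvw)
    have hwS : w ∈ S := hdw.1.resolve_left hwv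
    have hndw : ¬ Done G S w := fun h => hv (h.2 v hvw)
    have hc₁w : c₁ w = some .white := by rw [hc₁u w hwv, stageConfig_of_not_done hwS hndw]
    have hpred : PredecessorsPebbled G c₁ w := by
      intro u hu
      rcases eq_or_ne u v with rfl | huv
      · simp [hc₁v]
      · rw [hc₁u u huv]
        exact stageConfig_ne_none huniq ((hdw.2 u hu).resolve_left huv) hu hndw
    -- The recolouring of `w` takes two moves, both legal because all predecessors of `w` are
    -- pebbled; the set of pebbled nodes afterwards is that of `c₁`.
    set c₂ : Config V := Function.update c₁ w none with hc₂
    have hmove₂ : BoundedMove G k c₁ c₂ := by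
      refine ⟨.removeWhite c₁ w hc₁w hpred, (Config.numPebbles_mono fun u hu => ?_).trans hnum⟩
      rcases eq_or_ne u w with rfl | huw
      · simp [hc₁w]
      · simpa [hc₂, huw] using hu
    set c₃ : Config V := Function.update c₂ w (some .black) with hc₃
    have hnum₃ : c₃.numPebbles ≤ k := by
      refine (Config.numPebbles_mono fun u hu => ?_).trans hnum
      rcases eq_or_ne u w with rfl | huw
      · simp [hc₁w]
      · simpa [hc₃, hc₂, huw] using hu
    have hmove₃ : BoundedMove G k c₂ c₃ := by
      refine ⟨.placeBlack c₂ w (by simp [hc₂]) fun u hu => ?_, hnum₃⟩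
      have huw : u ≠ w := fun h => hirr w (h ▸ hu)
      simpa [hc₂, huw] using hpred u hu
    refine .head hmove₂ (.head hmove₃ (reflTransGen_removeBlack hnum₃ fun u => ?_))
    rcases eq_or_ne u w with rfl | huw
    · simpa [hc₃] using (stageConfig_eq_black_or_none hdw)
    · have hc₃u : c₃ u = c₁ u := by simp [hc₃, hc₂, huw]
      rw [hc₃u]
      rcases eq_or_ne u v with rfl | huv
      · exact hfinal_v
      · rw [hc₁u u huv]
        exact stageConfig_insert huv fun h => huw (huniq v u w h.1 hvw)
  · refine reflTransGen_removeBlack hnum fun u => ?_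
    rcases eq_or_ne u v with rfl | huv
    · exact hfinal_v
    · rw [hc₁u u huv]
      exact stageConfig_insert huv fun h => hw ⟨u, h⟩

/-- Going through the nodes along an increasing sequence of sets gives a successful strategy. -/
lemma mem_sufficientPebbles_of_stages [DecidableEq V] [Finite V]
    (huniq : ∀ u v w, G.Adj u v → G.Adj u w → v = w) (hirr : ∀ v, ¬ G.Adj v v)
    (S : ℕ → Set V) (n k : ℕ) (hzero : S 0 = ∅) (hlast : S n = Set.univ)
    (hstep : ∀ t < n, ∃ v, S (t + 1) = insert v (S t))
    (hk : ∀ t < n, (stageConfig G (S t)).numPebbles + 1 ≤ k) : k ∈ sufficientPebbles G := by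
  have hreach : ∀ t ≤ n, ReflTransGen (BoundedMove G k) (fun _ => none) (stageConfig G (S t)) := by
    intro t
    induction t with
    | zero =>
      intro _
      have : stageConfig G (S 0) = fun _ => none :=
        funext fun u => stageConfig_of_notMem (by simp [hzero])
      rw [this]
    | succ t ih =>
      intro ht
      obtain ⟨v, hv⟩ := hstep t ht
      rw [hv]
      exact (ih (by omega)).trans (stageConfig_step huniq hirr (hk t ht))
  have hdone : ∀ v, Done G (S n) v := fun v => by simp [Done, hlast]
  refine mem_sufficientPebbles_of_reflTransGen (hreach n le_rfl) ⟨fun v hv => ?_, fun v => ?_⟩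
  · rw [stageConfig_of_done (hdone v) fun w hw => (hv w hw).elim]
    simp
  · rcases stageConfig_eq_black_or_none (hdone v) with h | h <;> simp [h]

/-- A pebbled node is one of the ends of an edge that leads from or to a mixed node, or a root. -/
lemma stageConfig_ne_none_imp {S : Set V} {u : V} (h : stageConfig G S u ≠ none) :
    (∃ x, G.Adj x u ∧ ¬ (x ∈ S ↔ u ∈ S)) ∨ (∀ w, ¬ G.Adj u w) ∨
      ∃ w, G.Adj u w ∧ ∃ x, G.Adj x w ∧ ¬ (x ∈ S ↔ w ∈ S) := by
  have hu : u ∈ S := by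
    by_contra hu
    exact h (stageConfig_of_notMem hu)
  by_cases hd : Done G S u
  · right
    by_contra! hcon
    obtain ⟨⟨w, hw⟩, hcon⟩ := hcon
    have hwS := (hcon w hw u hw).1 hu
    exact h (stageConfig_of_done_parent hd hw ⟨hwS, fun x hx => (hcon w hw x hx).2 hwS⟩)
  · left
    by_contra! hcon
    exact hd ⟨hu, fun x hx => (hcon x hx).2 hu⟩

/-! ### The lifetime of a pebble -/

/-- A new black pebble certifies its predecessors just after the move; dually, in `Move.white`, a
vanishing white pebble certifies them just before it. In both cases the node itself is pebbled at
the certified time. -/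
lemma Move.black {c c' : Config V} [DecidableEq V] (hirr : ∀ v, ¬ G.Adj v v) (h : Move G c c')
    {v : V} (hv : c' v = some .black) : c v = some .black ∨ PredecessorsPebbled G c' v := by
  have key : ∀ x (p : Option Pebble), p ≠ some .black → Function.update c x p v = some .black →
      c v = some .black := by
    intro x p hp hv
    rcases eq_or_ne v x with rfl | hvx
    · simp [hp] at hv
    · simpa [hvx] using hv
  cases h with
  | placeBlack x hx hpred =>
    rcases eq_or_ne v x with rfl | hvx
    · refine .inr fun u hu => ?_
      have huv : u ≠ v := fun h => hirr v (h ▸ hu)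
      simpa [huv] using hpred u hu
    · exact .inl (by simpa [hvx] using hv)
  | removeBlack x hx => exact .inl (key x _ (by simp) hv)
  | placeWhite x hx => exact .inl (key x _ (by simp) hv)
  | removeWhite x hx hpred => exact .inl (key x _ (by simp) hv)

lemma Move.white {c c' : Config V} [DecidableEq V] (h : Move G c c') {v : V}
    (hv : c v = some .white) : c' v = some .white ∨ PredecessorsPebbled G c v := by
  have key : ∀ x (p : Option Pebble), c x ≠ some .white → Function.update c x p v = some .white := by
    intro x p hx
    have hvx : v ≠ x := fun h => hx (h ▸ hv)
    simpa [hvx] using hv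
  cases h with
  | placeBlack x hx hpred => exact .inl (key x _ (by simp [hx]))
  | removeBlack x hx => exact .inl (key x _ (by simp [hx]))
  | placeWhite x hx => exact .inl (key x _ (by simp [hx]))
  | removeWhite x hx hpred =>
    rcases eq_or_ne v x with rfl | hvx
    · exact .inr hpred
    · exact .inl (by simpa [hvx] using hv)

/-- If a node is pebbled at some time, then it keeps its pebble up to or from a time when all its
immediate predecessors are pebbled. -/
lemma exists_predecessorsPebbled [DecidableEq V] (hirr : ∀ v, ¬ G.Adj v v) {c : ℕ → Config V}
    {T : ℕ} (hzero : c 0 = fun _ => none) (hmove : ∀ t < T, Move G (c t) (c (t + 1)))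
    (hgoal : IsGoal G (c T)) {v : V} {t : ℕ} (ht : t ≤ T) (hv : c t v ≠ none) :
    ∃ τ ≤ T, PredecessorsPebbled G (c τ) v ∧
      ∀ t', min t τ ≤ t' → t' ≤ max t τ → c t' v ≠ none := by
  -- A black pebble is followed backwards to its placement, which exists since the start is empty; a
  -- white one forwards to its removal, which exists since the goal has no white pebbles.
  rcases hc : c t v with _ | _ | _
  · exact absurd hc hv
  · clear hv
    induction t with
    | zero => simp [hzero] at hc
    | succ t ih =>
      rcases (hmove t ht).black hirr hc with h | h
      · obtain ⟨τ, hτ, hpred, hint⟩ := ih (by omega) h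
        refine ⟨τ, hτ, hpred, fun t' h₁ h₂ => ?_⟩
        by_cases h₃ : t' = t + 1
        · simp [h₃, hc]
        · exact hint t' (by omega) (by omega)
      · exact ⟨t + 1, ht, h, fun t' h₁ h₂ => by simp [show t' = t + 1 by omega, hc]⟩
  · clear hv
    induction ht using Nat.decreasingInduction with
    | self => exact absurd hc (hgoal.2 v)
    | of_succ t ht ih =>
      rcases (hmove t ht).white hc with h | h
      · obtain ⟨τ, hτ, hpred, hint⟩ := ih h
        refine ⟨τ, hτ, hpred, fun t' h₁ h₂ => ?_⟩
        by_cases h₃ : t' = t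
        · simp [h₃, hc]
        · exact hint t' (by omega) (by omega)
      · exact ⟨t, ht.le, h, fun t' h₁ h₂ => by simp [show t' = t by omega, hc]⟩

end Pebbling

/-! ### Sets of nodes as sets of positions; from re-pairings to strategies -/

namespace DyckWord

open DyckStep OrderedForest

/-- The positions of the symbols that delimit the nodes from `S`. -/
def positions (σ : DyckWord) (S : Set σ.forest.Node) : Set ℕ :=
  {i | ∃ s, ∃ v ∈ S, (σ.labels [] 0)[i]? = some (s, v.1)}

lemma mem_positions {σ : DyckWord} {S : Set σ.forest.Node} {i : ℕ} {s : DyckStep}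
    {v : σ.forest.Node} (h : (σ.labels [] 0)[i]? = some (s, v.1)) : i ∈ σ.positions S ↔ v ∈ S := by
  constructor
  · rintro ⟨s', v', hv', h'⟩
    rw [h] at h'
    have : v = v' := Subtype.ext (Prod.mk.inj (Option.some.inj h')).2
    exact this ▸ hv'
  · exact fun hv => ⟨s, v, hv, h⟩

lemma exists_label (σ : DyckWord) (v : σ.forest.Node) (s : DyckStep) :
    ∃ i : ℕ, (σ.labels [] 0)[i]? = some (s, v.1) :=
  List.mem_iff_getElem?.1 (mem_labels_root.2 v.2)

lemma exists_node {σ : DyckWord} {i : ℕ} {x : DyckStep × List ℕ}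
    (h : (σ.labels [] 0)[i]? = some x) : ∃ v : σ.forest.Node, v.1 = x.2 :=
  ⟨⟨x.2, mem_labels_root.1 (List.mem_of_getElem? h)⟩, rfl⟩

lemma nextLabel_labels {σ : DyckWord} {b : List ℕ} {k i : ℕ} {x y : DyckStep × List ℕ}
    (hx : (σ.labels b k)[i]? = some x) (hy : (σ.labels b k)[i + 1]? = some y) :
    NextLabel x y := by
  obtain ⟨_, rfl⟩ := List.getElem?_eq_some_iff.1 hx
  obtain ⟨h, rfl⟩ := List.getElem?_eq_some_iff.1 hy
  exact List.isChain_iff_getElem.1 (isChain_labels σ b k) i h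

/-- The address of the innermost node that is open after a symbol has been read. -/
def openNode : DyckStep × List ℕ → List ℕ
  | (U, v) => v
  | (D, v) => v.dropLast

/-- If there is a node with exactly one of the node and a child of it in `S`, then the positions of
`S` change between two consecutive positions for which this is the innermost open node. -/
lemma exists_change {σ : DyckWord} {S : Set σ.forest.Node} {w x : σ.forest.Node}
    (hxw : σ.forest.graph.Adj x w) (hS : ¬ (x ∈ S ↔ w ∈ S)) :
    ∃ i, ¬ (i ∈ σ.positions S ↔ i + 1 ∈ σ.positions S) ∧
      (σ.labels [] 0)[i]?.map openNode = some w.1 := by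
  by_contra! hcon
  have hcon' : ∀ i, (σ.labels [] 0)[i]?.map openNode = some w.1 →
      (i ∈ σ.positions S ↔ i + 1 ∈ σ.positions S) := fun i hi => by
    by_contra h
    exact hcon i (by tauto) hi
  obtain ⟨j, hj⟩ := hxw
  refine hS ?_
  clear hS
  -- The opening symbol of a child is never the first symbol of the word, since that one carries the
  -- one-letter address `[0]`.
  have hpred : ∀ (j : ℕ) (x : σ.forest.Node), x.1 = w.1 ++ [j] → ∃ i l,
      (σ.labels [] 0)[i + 1]? = some (U, x.1) ∧ (σ.labels [] 0)[i]? = some l ∧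
        NextLabel l (U, w.1 ++ [j]) := by
    intro j x hx
    obtain ⟨i, hi⟩ := exists_label σ x U
    rcases i with _ | i
    · have := head?_labels (List.head?_eq_getElem? ▸ hi)
      rw [hx] at this
      exact absurd (List.append_eq_singleton_iff.1 (Prod.mk.inj this).2) (by simp [w.ne_nil])
    · have hlt := (List.getElem?_eq_some_iff.1 hi).1
      have hl : (σ.labels [] 0)[i]? = some ((σ.labels [] 0)[i]) :=
        List.getElem?_eq_getElem (by omega)
      exact ⟨i, _, hi, hl, hx ▸ nextLabel_labels hl hi⟩
  -- Membership in `S` is carried from the opening of `w` to its child 0, then from the closing of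
  -- each child to the opening of the next: both symbols of a node have the same status, and `w` is
  -- the innermost open node at each crossing.
  induction j generalizing x with
  | zero =>
    obtain ⟨i, l, hi, hl, hnext⟩ := hpred 0 x hj
    generalize hy : w.1 ++ [0] = y at hnext
    cases hnext with
    | down v =>
      obtain rfl : w.1 = v := List.append_inj_left' hy rfl
      rw [← mem_positions hi, ← mem_positions hl]
      exact (hcon' i (by simp [hl, openNode])).symm
    | sibling w' j' => simpa using congrArg List.getLast? hy
  | succ j ih =>
    obtain ⟨i, l, hi, hl, hnext⟩ := hpred (j + 1) x hj
    generalize hy : w.1 ++ [j + 1] = y at hnext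
    cases hnext with
    | down v => simpa using congrArg List.getLast? hy
    | sibling w' j' =>
      obtain ⟨rfl, hj'⟩ := List.append_inj' hy rfl
      obtain rfl : j = j' := by simpa using hj'
      obtain ⟨x', hx'⟩ := exists_node hl
      have hx'w : x' ∈ S ↔ w ∈ S := ih hx'
      rw [← hx'w, ← mem_positions hi, ← mem_positions (v := x') (s := D) (by rw [hl, hx'])]
      exact (hcon' i (by simp [hl, openNode])).symm

lemma finite_positions (σ : DyckWord) (S : Set σ.forest.Node) : (σ.positions S).Finite :=
  (Set.finite_Iio (σ.labels [] 0).length).subset fun _ ⟨_, _, _, h⟩ =>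
    (List.getElem?_eq_some_iff.1 h).1

/-- Different mixed nodes get different changes from `exists_change`, as the position determines the
innermost open node. The factor 2 counts exits and entries. -/
lemma ncard_mixed_le (σ : DyckWord) (S : Set σ.forest.Node) :
    {w | ∃ x, σ.forest.graph.Adj x w ∧ ¬ (x ∈ S ↔ w ∈ S)}.ncard ≤
      2 * Repairing.setWidth (σ.positions S) := by
  set E := σ.positions S with hE
  have hfin := finite_positions σ S
  set B := {i | i ∈ E ∧ i + 1 ∉ E} ∪ {i | i ∉ E ∧ i + 1 ∈ E} with hB
  have hBcard : B.ncard ≤ 2 * Repairing.setWidth E := by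
    have h₁ := Repairing.ncard_exits_le_setWidth (S := E) hfin
    have h₂ := Repairing.ncard_entries_le_setWidth (S := E) hfin
    have := Set.ncard_union_le {i | i ∈ E ∧ i + 1 ∉ E} {i | i ∉ E ∧ i + 1 ∈ E}
    rw [hB]
    omega
  have hBfin : B.Finite := by
    refine (hfin.subset fun i hi => hi.1).union ?_
    exact (hfin.preimage (f := (· + 1)) (add_left_injective 1).injOn).subset fun i hi => hi.2
  refine le_trans ?_ hBcard
  rw [← Set.ncard_image_of_injective _ Subtype.val_injective]
  refine le_trans ?_
    (Set.ncard_image_le (f := fun i => ((σ.labels [] 0)[i]?.map openNode).getD []) hBfin)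
  refine Set.ncard_le_ncard ?_ (hBfin.image _)
  rintro _ ⟨w, ⟨x, hxw, hx⟩, rfl⟩
  obtain ⟨i, hi, hw⟩ := exists_change hxw hx
  refine ⟨i, ?_, by simp [hw]⟩
  by_cases h : i ∈ E
  · exact .inl ⟨h, fun h' => hi (iff_of_true h h')⟩
  · exact .inr ⟨h, by_contra fun h' => hi (iff_of_false h h')⟩

/-- Three addresses for each mixed node (itself and its at most two children), at most twice the
width many mixed nodes, and 1 for the root. -/
lemma numPebbles_stageConfig_le {σ : DyckWord} (htree : σ.forest.IsTree)
    (hbin : σ.forest.IsBinary) (S : Set σ.forest.Node) :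
    (Pebbling.stageConfig σ.forest.graph S).numPebbles ≤
      6 * Repairing.setWidth (σ.positions S) + 1 := by
  have hM := ncard_mixed_le σ S
  set M := {w | ∃ x, σ.forest.graph.Adj x w ∧ ¬ (x ∈ S ↔ w ∈ S)} with hMdef
  set M' : Set (List ℕ) := Subtype.val '' M with hM'
  have hM'card : M'.ncard = M.ncard := Set.ncard_image_of_injective _ Subtype.val_injective
  have hfin : M'.Finite := M.toFinite.image _
  have h₀ := Set.ncard_image_le (f := fun a : List ℕ => a ++ [0]) hfin
  have h₁ := Set.ncard_image_le (f := fun a : List ℕ => a ++ [1]) hfin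
  have h₂ := Set.ncard_union_le ((fun a : List ℕ => a ++ [0]) '' M')
    ((fun a : List ℕ => a ++ [1]) '' M')
  have h₃ := Set.ncard_union_le M'
    (((fun a : List ℕ => a ++ [0]) '' M') ∪ ((fun a : List ℕ => a ++ [1]) '' M'))
  have h₄ := Set.ncard_insert_le [0]
    (M' ∪ (((fun a : List ℕ => a ++ [0]) '' M') ∪ ((fun a : List ℕ => a ++ [1]) '' M')))
  refine le_trans (b := (insert [0] (M' ∪ (((fun a : List ℕ => a ++ [0]) '' M') ∪
    ((fun a : List ℕ => a ++ [1]) '' M')))).ncard) ?_ (by omega)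
  rw [Pebbling.Config.numPebbles, ← Set.ncard_image_of_injective _ Subtype.val_injective]
  refine Set.ncard_le_ncard ?_
    ((hfin.union ((hfin.image _).union (hfin.image _))).insert _)
  rintro _ ⟨u, hu, rfl⟩
  rcases Pebbling.stageConfig_ne_none_imp hu with h | h | ⟨w, ⟨i, hi⟩, hw⟩
  · exact .inr (.inl ⟨u, h, rfl⟩)
  · rcases Node.root_or_adj u with ⟨i, hi⟩ | ⟨w, hw⟩
    · have := htree.eq_zero (hi ▸ u.2)
      exact .inl (by rw [hi, this])
    · exact absurd hw (h w)
  · have : i < 2 := hbin.lt_two w.ne_nil (hi ▸ u.2)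
    refine .inr (.inr ?_)
    interval_cases i
    · exact .inl ⟨w.1, ⟨w, hw, rfl⟩, hi.symm⟩
    · exact .inr ⟨w.1, ⟨w, hw, rfl⟩, hi.symm⟩

/-- The nodes whose symbols are erased by a simple re-pairing by the time `t`. -/
def erasedNodes (σ : DyckWord) (p : List (ℕ × ℕ)) (t : ℕ) : Set σ.forest.Node :=
  {v | ∃ q ∈ p.take t, (σ.labels [] 0)[q.1]? = some (U, v.1)}

/-- Simplicity enters here: each pair consists of exactly the two symbols of one node. -/
lemma IsSimpleRepairing.erased_eq {σ : DyckWord} {p : List (ℕ × ℕ)} (hp : σ.IsSimpleRepairing p)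
    (t : ℕ) : Repairing.erased p t = σ.positions (σ.erasedNodes p t) := by
  ext i
  constructor
  · rintro ⟨q, hq, hi⟩
    obtain ⟨a, hU, hD⟩ := (hp.simple q (List.mem_of_mem_take hq)).labels [] 0
    obtain ⟨v, rfl⟩ := exists_node hU
    have hv : v ∈ σ.erasedNodes p t := ⟨q, hq, hU⟩
    rcases hi with rfl | rfl
    · exact ⟨_, v, hv, hU⟩
    · exact ⟨_, v, hv, hD⟩
  · rintro ⟨s, v, ⟨q, hq, hqU⟩, hi⟩
    obtain ⟨a, hU, hD⟩ := (hp.simple q (List.mem_of_mem_take hq)).labels [] 0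
    obtain rfl : v.1 = a := by
      rw [hqU] at hU
      exact (Prod.mk.inj (Option.some.inj hU)).2
    refine ⟨q, hq, ?_⟩
    cases s
    · exact .inl (getElem?_labels_inj hi hU)
    · exact .inr (getElem?_labels_inj hi hD)

/-- Simple re-pairings give strategies for the pebble game. -/
lemma IsSimpleRepairing.mem_sufficientPebbles {σ : DyckWord} (htree : σ.forest.IsTree)
    (hbin : σ.forest.IsBinary) {p : List (ℕ × ℕ)} (hp : σ.IsSimpleRepairing p) :
    6 * Repairing.width p + 2 ∈ Pebbling.sufficientPebbles σ.forest.graph := by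
  refine Pebbling.mem_sufficientPebbles_of_stages (fun _ _ _ => graph_adj_unique) graph_irrefl
    (σ.erasedNodes p) p.length _ (by simp [erasedNodes]) ?_ ?_ ?_
  · refine Set.eq_univ_of_forall fun v => ?_
    obtain ⟨i, hi⟩ := exists_label σ v U
    obtain ⟨k, hk, -⟩ := hp.exactly_one i
      (by rw [← length_labels σ [] 0]; exact (List.getElem?_eq_some_iff.1 hi).1)
    have hmem : i ∈ Repairing.erased p p.length :=
      ⟨p.get k, by simp, hk.imp Eq.symm Eq.symm⟩
    rwa [hp.erased_eq, mem_positions hi] at hmem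
  · intro t ht
    obtain ⟨a, hU, -⟩ := (hp.simple p[t] (List.getElem_mem ht)).labels [] 0
    obtain ⟨v, rfl⟩ := exists_node hU
    refine ⟨v, ?_⟩
    ext u
    simp only [erasedNodes, List.take_add_one, List.getElem?_eq_getElem ht, List.mem_append,
      Option.toList_some, List.mem_singleton, Set.mem_ofPred_eq, Set.mem_insert_iff]
    constructor
    · rintro ⟨q, hq | rfl, hqu⟩
      · exact .inr ⟨q, hq, hqu⟩
      · rw [hU] at hqu
        exact .inl (Subtype.ext (Prod.mk.inj (Option.some.inj hqu)).2.symm)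
    · rintro (rfl | ⟨q, hq, hqu⟩)
      · exact ⟨_, .inr rfl, hU⟩
      · exact ⟨q, .inl hq, hqu⟩
  · intro t ht
    have h₁ := numPebbles_stageConfig_le htree hbin (σ.erasedNodes p t)
    have h₂ := Repairing.setWidth_erased_le_width p ht.le
    rw [hp.erased_eq] at h₂
    omega

/-- Every enumeration of the nodes gives a simple re-pairing. -/
lemma exists_isSimpleRepairing (σ : DyckWord) {l : List σ.forest.Node} (hl : l.Nodup)
    (hall : ∀ v, v ∈ l) : ∃ p, σ.IsSimpleRepairing p ∧
      ∀ t, σ.erasedNodes p t = {v | v ∈ l.take t} := by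
  have hpair : ∀ v : σ.forest.Node, ∃ q : ℕ × ℕ, σ.Matched q.1 q.2 ∧
      (σ.labels [] 0)[q.1]? = some (U, v.1) ∧ (σ.labels [] 0)[q.2]? = some (D, v.1) := fun v => by
    obtain ⟨i, j, h⟩ := exists_matched (mem_labels_root (x := (U, v.1)).2 v.2)
    exact ⟨(i, j), h⟩
  choose q hq hqU hqD using hpair
  have hsymbol : ∀ {i : ℕ} {s : DyckStep} {v : List ℕ}, (σ.labels [] 0)[i]? = some (s, v) →
      σ.toList[i]? = some s := fun {i s v} h => by
    rw [← map_fst_labels σ [] 0, List.getElem?_map, h]; rfl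
  refine ⟨l.map q, ⟨⟨?_, ?_, ?_⟩, ?_⟩, ?_⟩
  -- The nodes correspond to the opening symbols, whose number is the semilength.
  · have hperm : (l.map fun v => (U, v.1)).Perm
        ((σ.labels [] 0).filter fun x => x.1 == U) := by
      refine (List.perm_ext_iff_of_nodup (hl.map fun u v h => Subtype.ext (Prod.mk.inj h).2)
        ((nodup_labels σ [] 0).filter _)).2 fun x => ?_
      simp only [List.mem_map, List.mem_filter, beq_iff_eq, mem_labels_root]
      constructor
      · rintro ⟨v, -, rfl⟩
        exact ⟨v.2, rfl⟩
      · rintro ⟨h, h'⟩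
        exact ⟨⟨x.2, h⟩, hall _, by rw [← h']⟩
    have hlen := hperm.length_eq
    rw [List.length_map, ← List.countP_eq_length_filter] at hlen
    rw [List.length_map, hlen, semilength, ← map_fst_labels σ [] 0, List.count, List.countP_map]
    rfl
  · intro x hx
    obtain ⟨v, -, rfl⟩ := List.mem_map.1 hx
    exact ⟨hsymbol (hqU v), hsymbol (hqD v), (hq v).lt⟩
  · intro i hi
    rw [← length_labels σ [] 0] at hi
    obtain ⟨⟨s, a⟩, hx⟩ : ∃ x, (σ.labels [] 0)[i]? = some x := ⟨_, List.getElem?_eq_getElem hi⟩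
    obtain ⟨v, rfl⟩ := exists_node hx
    obtain ⟨k, hk, hkv⟩ := List.getElem_of_mem (hall v)
    refine ⟨⟨k, by simpa using hk⟩, ?_, ?_⟩
    · simp only [List.get_eq_getElem, List.getElem_map, hkv]
      cases s
      · exact .inl (getElem?_labels_inj (hqU v) hx)
      · exact .inr (getElem?_labels_inj (hqD v) hx)
    · rintro ⟨k', hk'⟩ h
      simp only [List.get_eq_getElem, List.getElem_map] at h
      have hk'' : k' < l.length := by simpa using hk'
      have hv : l[k'] = v := by
        rcases h with h | h
        · have := hqU l[k']
          rw [h, hx] at this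
          exact Subtype.ext (Prod.mk.inj (Option.some.inj this)).2.symm
        · have := hqD l[k']
          rw [h, hx] at this
          exact Subtype.ext (Prod.mk.inj (Option.some.inj this)).2.symm
      exact Fin.ext ((hl.getElem_inj_iff (hi := hk'') (hj := hk)).1 (hv.trans hkv.symm))
  · intro x hx
    obtain ⟨v, -, rfl⟩ := List.mem_map.1 hx
    exact hq v
  · intro t
    ext v
    simp only [erasedNodes, ← List.map_take, List.mem_map, Set.mem_ofPred_eq]
    constructor
    · rintro ⟨_, ⟨u, hu, rfl⟩, h⟩
      rw [hqU] at h
      have : u = v := Subtype.ext (Prod.mk.inj (Option.some.inj h)).2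
      exact this ▸ hu
    · exact fun hv => ⟨_, ⟨v, hv, rfl⟩, hqU v⟩

end DyckWord

/-! ### Intersecting intervals of pebbled times -/

namespace OrderedForest

open Pebbling

/-- In a strategy for the pebble game on a forest, every node has an interval of times during which
it is pebbled, such that the intervals of a node and of its parent intersect. -/
lemma exists_pebbled_intervals {F : OrderedForest} {c : ℕ → Config F.Node} {T : ℕ}
    (hzero : c 0 = fun _ => none) (hmove : ∀ t < T, Move F.graph (c t) (c (t + 1)))
    (hgoal : IsGoal F.graph (c T)) :
    ∃ lo hi : F.Node → ℕ, (∀ v t, lo v ≤ t → t ≤ hi v → c t v ≠ none) ∧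
      ∀ u v, F.graph.Adj u v → ∃ t, lo u ≤ t ∧ t ≤ hi u ∧ lo v ≤ t ∧ t ≤ hi v := by
  have hτ : ∀ (v : F.Node) (t : ℕ), ∃ τ, t ≤ T → c t v ≠ none → τ ≤ T ∧
      PredecessorsPebbled F.graph (c τ) v ∧
        ∀ t', min t τ ≤ t' → t' ≤ max t τ → c t' v ≠ none := by
    intro v t
    by_cases h : t ≤ T ∧ c t v ≠ none
    · obtain ⟨τ, hτ⟩ := exists_predecessorsPebbled graph_irrefl hzero hmove hgoal h.1 h.2
      exact ⟨τ, fun _ _ => hτ⟩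
    · exact ⟨0, fun h₁ h₂ => absurd ⟨h₁, h₂⟩ h⟩
  choose τ hτ using hτ
  classical
  -- the time when the children of a node are pebbled, by recursion on the reversed address
  let f : List ℕ → ℕ := fun a => List.rec T (fun i w t =>
    if h : (F.subtreeAt (i :: w).reverse).isSome then τ ⟨_, h⟩ t else 0) a
  let g : List ℕ → ℕ := fun a => f a.reverse
  have g_append : ∀ (v : F.Node) (w : List ℕ) (i : ℕ), v.1 = w ++ [i] → g v.1 = τ v (g w) := by
    rintro ⟨_, hv⟩ w i rfl
    have hrev : (w ++ [i]).reverse = i :: w.reverse := by simp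
    -- `List.rec` strips the head, so addresses are reversed to make it strip the last index and
    -- pass to the parent.
    have hv' : (F.subtreeAt (i :: w.reverse).reverse).isSome := by
      rwa [← hrev, List.reverse_reverse]
    change f (w ++ [i]).reverse = _
    rw [hrev]
    change (if h : (F.subtreeAt (i :: w.reverse).reverse).isSome then
      τ ⟨_, h⟩ (f w.reverse) else 0) = _
    rw [dif_pos hv']
    exact congrArg (fun u => τ u (f w.reverse)) (Subtype.ext
      ((congrArg List.reverse hrev.symm).trans (List.reverse_reverse _)))
  have hstart : ∀ (a : List ℕ) (v : F.Node), v.1 = a →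
      g v.1.dropLast ≤ T ∧ c (g v.1.dropLast) v ≠ none := by
    intro a
    induction a using List.reverseRecOn with
    | nil => exact fun v hv => absurd hv v.ne_nil
    | append_singleton w i ih =>
      intro v hv
      rw [hv, List.dropLast_concat]
      rcases eq_or_ne w [] with rfl | hw
      · refine ⟨le_rfl, hgoal.1 v ?_⟩
        rintro u ⟨j, hj⟩
        rw [hv] at hj
        have := congrArg List.length hj
        exact u.ne_nil (List.eq_nil_of_length_eq_zero (by simpa using this.symm))
      · let w' : F.Node := ⟨w, isSome_subtreeAt_of_append hw (hv ▸ v.2)⟩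
        obtain ⟨h₁, h₂⟩ := ih w' rfl
        obtain ⟨h₃, h₄, -⟩ := hτ w' _ h₁ h₂
        have hlast : w'.1 = w.dropLast ++ [w.getLast hw] := (List.dropLast_append_getLast hw).symm
        have hg : g w = τ w' (g w.dropLast) := g_append w' _ _ hlast
        rw [hg]
        exact ⟨h₃, h₄ v ⟨i, hv⟩⟩
  -- A node is pebbled between the time chosen for its parent and its own, in whichever order these
  -- come; the root uses the final time `T = g []`. Parent and child share the time chosen for the
  -- parent.
  refine ⟨fun v => min (g v.1.dropLast) (g v.1), fun v => max (g v.1.dropLast) (g v.1), ?_, ?_⟩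
  · intro v t h₁ h₂
    have hlast : v.1 = v.1.dropLast ++ [v.1.getLast v.ne_nil] :=
      (List.dropLast_append_getLast v.ne_nil).symm
    obtain ⟨h₃, h₄⟩ := hstart v.1 v rfl
    refine (hτ v _ h₃ h₄).2.2 t ?_ ?_ <;> rwa [← g_append v _ _ hlast]
  · rintro u v ⟨i, hi⟩
    have hu : u.1.dropLast = v.1 := by rw [hi, List.dropLast_concat]
    refine ⟨g v.1, ?_, ?_, min_le_right _ _, le_max_right _ _⟩
    · exact hu ▸ min_le_left _ _
    · exact hu ▸ le_max_left _ _

end OrderedForest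

/-! ### From strategies to re-pairings -/

namespace DyckWord

open DyckStep OrderedForest Pebbling

/-- If every edge of the forest that leaves `S` has a pebble at its end in `S`, then the width of
`S` is bounded in terms of the number of pebbles. -/
lemma setWidth_positions_le {σ : DyckWord} (htree : σ.forest.IsTree) (hbin : σ.forest.IsBinary)
    {S A : Set σ.forest.Node} (hA : ∀ u v, σ.forest.graph.Adj u v ∨ σ.forest.graph.Adj v u →
      u ∈ S → v ∉ S → u ∈ A) :
    Repairing.setWidth (σ.positions S) ≤ 6 * A.ncard + 1 := by
  refine (Repairing.setWidth_le_ncard (finite_positions σ S)).trans ?_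
  set A' : Set (List ℕ) := Subtype.val '' A with hA'
  have hA'card : A'.ncard = A.ncard := Set.ncard_image_of_injective _ Subtype.val_injective
  have hfin : A'.Finite := A.toFinite.image _
  -- The node at an exit, other than the end of the word, is in `A` or is a child of a node of `A`.
  -- With two symbols per node this gives `2 * 3 * A.ncard`, and the last position gives the extra
  -- 1.
  set Z := A' ∪ ((fun a : List ℕ => a ++ [0]) '' A' ∪ (fun a : List ℕ => a ++ [1]) '' A') with hZ
  have hZfin : Z.Finite := hfin.union ((hfin.image _).union (hfin.image _))
  have hZcard : Z.ncard ≤ 3 * A.ncard := by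
    have h₀ := Set.ncard_image_le (f := fun a : List ℕ => a ++ [0]) hfin
    have h₁ := Set.ncard_image_le (f := fun a : List ℕ => a ++ [1]) hfin
    have h₂ := Set.ncard_union_le ((fun a : List ℕ => a ++ [0]) '' A')
      ((fun a : List ℕ => a ++ [1]) '' A')
    have h₃ := Set.ncard_union_le A'
      ((fun a : List ℕ => a ++ [0]) '' A' ∪ (fun a : List ℕ => a ++ [1]) '' A')
    rw [hZ]
    omega
  let pos : DyckStep → List ℕ → ℕ := fun s a => (σ.labels [] 0).idxOf (s, a)
  have hpos : ∀ {i : ℕ} {s : DyckStep} {a : List ℕ}, (σ.labels [] 0)[i]? = some (s, a) →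
      pos s a = i := fun {i s a} h =>
    getElem?_labels_inj (List.getElem?_idxOf (List.mem_of_getElem? h)) h
  have hU := Set.ncard_image_le (f := pos U) hZfin
  have hD := Set.ncard_image_le (f := pos D) hZfin
  have hUD := Set.ncard_union_le (pos U '' Z) (pos D '' Z)
  have hins := Set.ncard_insert_le ((σ.labels [] 0).length - 1) (pos U '' Z ∪ pos D '' Z)
  refine le_trans (Set.ncard_le_ncard (t := insert ((σ.labels [] 0).length - 1)
    (pos U '' Z ∪ pos D '' Z)) ?_ (((hZfin.image _).union (hZfin.image _)).insert _)) (by omega)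
  rintro i ⟨⟨s, x, hxS, hx⟩, hi⟩
  by_cases hlast : i + 1 = (σ.labels [] 0).length
  · exact .inl (by omega)
  right
  suffices hmem : x.1 ∈ Z by
    cases s
    · exact .inl ⟨x.1, hmem, hpos hx⟩
    · exact .inr ⟨x.1, hmem, hpos hx⟩
  have hlt : i + 1 < (σ.labels [] 0).length := by
    have := (List.getElem?_eq_some_iff.1 hx).1
    omega
  obtain ⟨⟨s', a⟩, hy⟩ : ∃ y, (σ.labels [] 0)[i + 1]? = some y := ⟨_, List.getElem?_eq_getElem hlt⟩
  obtain ⟨y, rfl⟩ := exists_node hy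
  have hyS : y ∉ S := fun h => hi ((mem_positions hy).2 h)
  have hnext := nextLabel_labels hx hy
  generalize hl : (s, x.1) = l at hnext
  generalize hl' : (s', y.1) = l' at hnext
  cases hnext with
  | down v =>
    obtain ⟨-, rfl⟩ := Prod.mk.inj hl
    exact .inl ⟨x, hA x y (.inr ⟨0, (Prod.mk.inj hl').2⟩) hxS hyS, rfl⟩
  | leaf v =>
    have : x = y := Subtype.ext ((Prod.mk.inj hl).2.trans (Prod.mk.inj hl').2.symm)
    exact absurd (this ▸ hxS) hyS
  | up w j =>
    obtain ⟨-, rfl⟩ := Prod.mk.inj hl'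
    exact .inl ⟨x, hA x y (.inl ⟨j, (Prod.mk.inj hl).2⟩) hxS hyS, rfl⟩
  | sibling w j =>
    have hxw := (Prod.mk.inj hl).2
    have hyw := (Prod.mk.inj hl').2
    have hw : w ≠ [] := by
      rintro rfl
      have hy' := y.2
      rw [hyw] at hy'
      have := htree.eq_zero hy'
      omega
    let w' : σ.forest.Node := ⟨w, isSome_subtreeAt_of_append hw (hxw ▸ x.2)⟩
    -- Siblings are not adjacent, so the boundary edge runs through the parent: to the later sibling
    -- if the parent is in `S`, from `x` to the parent otherwise.
    by_cases hwS : w' ∈ S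
    · have hwA : w ∈ A' := ⟨w', hA w' y (.inr ⟨j + 1, hyw⟩) hwS hyS, rfl⟩
      have hj : j < 2 := hbin.lt_two hw (hxw ▸ x.2)
      rw [hxw]
      interval_cases j
      · exact .inr (.inl ⟨w, hwA, rfl⟩)
      · exact .inr (.inr ⟨w, hwA, rfl⟩)
    · exact .inl ⟨x, hA x w' (.inl ⟨j, hxw⟩) hxS hwS, rfl⟩

/-- Strategies for the pebble game give simple re-pairings. -/
lemma exists_isSimpleRepairing_of_sufficientPebbles {σ : DyckWord} (htree : σ.forest.IsTree)
    (hbin : σ.forest.IsBinary) {k : ℕ} (hk : k ∈ sufficientPebbles σ.forest.graph) :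
    ∃ p, σ.IsSimpleRepairing p ∧ Repairing.width p ≤ 6 * k + 1 := by
  obtain ⟨s, hs, ⟨cT, hcT, hgoal⟩, hbound⟩ := hk
  obtain ⟨T, hT, rfl⟩ := List.getElem_of_mem hcT
  -- The empty default keeps the pebble bound valid at all times, so the threshold `θ` below needs
  -- no upper bound.
  let c : ℕ → Config σ.forest.Node := fun t => s[t]?.getD fun _ => none
  have hc : ∀ {t} (ht : t < s.length), c t = s[t] := fun {t} ht => by simp [c, ht]
  have hzero : c 0 = fun _ => none := by
    have := hs.start
    rw [List.head?_eq_getElem?] at this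
    simp [c, this]
  have hmove : ∀ t < T, Move σ.forest.graph (c t) (c (t + 1)) := fun t ht => by
    rw [hc (by omega : t < s.length), hc (by omega : t + 1 < s.length)]
    exact List.isChain_iff_getElem.1 hs.moves t (by omega)
  have hnum : ∀ t, (c t).numPebbles ≤ k := fun t => by
    by_cases ht : t < s.length
    · rw [hc ht]
      exact hbound _ (List.getElem_mem ht)
    · simp [c, List.getElem?_eq_none (not_lt.1 ht), Config.numPebbles]
  obtain ⟨lo, hi, hpeb, hcommon⟩ := exists_pebbled_intervals hzero hmove
    (by rwa [hc hT] : IsGoal σ.forest.graph (c T))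
  have := Fintype.ofFinite σ.forest.Node
  let l : List σ.forest.Node := Finset.univ.toList.mergeSort fun u v => decide (lo u ≤ lo v)
  have hperm : l.Perm Finset.univ.toList := List.mergeSort_perm _ _
  have hl : l.Nodup := hperm.nodup_iff.2 (Finset.nodup_toList _)
  have hall : ∀ v, v ∈ l := fun v => hperm.mem_iff.2 (Finset.mem_toList.2 (Finset.mem_univ v))
  have hsorted : l.Pairwise fun u v => lo u ≤ lo v := by
    refine (List.pairwise_mergeSort ?_ ?_ _).imp of_decide_eq_true
    · intro u v w h₁ h₂
      exact decide_eq_true ((of_decide_eq_true h₁).trans (of_decide_eq_true h₂))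
    · intro u v
      simpa using le_total (lo u) (lo v)
  obtain ⟨p, hp, herased⟩ := exists_isSimpleRepairing σ hl hall
  refine ⟨p, hp, Finset.sup_le fun t _ => ?_⟩
  rw [hp.erased_eq, herased]
  -- The threshold is the left end of the first node not yet erased, or the maximal left end if none
  -- remains.
  obtain ⟨θ, hbefore, hafter⟩ : ∃ θ, (∀ v ∈ l.take t, lo v ≤ θ) ∧
      ∀ v, v ∉ l.take t → θ ≤ lo v := by
    by_cases ht : t < l.length
    · have hdrop : l.drop t = l[t] :: l.drop (t + 1) := List.drop_eq_getElem_cons ht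
      have hsplit := hsorted
      rw [← List.take_append_drop t l, List.pairwise_append] at hsplit
      refine ⟨lo l[t], fun v hv => hsplit.2.2 v hv _ (by
        rw [hdrop]
        exact List.mem_cons_self), fun v hv => ?_⟩
      have hv' : v ∈ l.drop t := by
        have := hall v
        rw [← List.take_append_drop t l, List.mem_append] at this
        exact this.resolve_left hv
      rw [hdrop] at hv' hsplit
      rcases List.mem_cons.1 hv' with rfl | hv'
      · exact le_rfl
      · exact (List.pairwise_cons.1 hsplit.2.1).1 v hv'
    · refine ⟨Finset.univ.sup lo, fun v _ => Finset.le_sup (Finset.mem_univ v), fun v hv => ?_⟩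
      rw [List.take_of_length_le (not_lt.1 ht)] at hv
      exact absurd (hall v) hv
  refine (setWidth_positions_le htree hbin (A := {v | c θ v ≠ none}) ?_).trans
    (by have := hnum θ; rw [Config.numPebbles] at this; omega)
  intro u v huv hu hv
  have hul := hbefore u hu
  have hvl := hafter v hv
  -- A common time of the two intervals yields `lo u ≤ θ ≤ lo v ≤ t' ≤ hi u`, so `u` is pebbled at
  -- `θ`.
  obtain ⟨t', h₁, h₂⟩ : ∃ t', t' ≤ hi u ∧ lo v ≤ t' := by
    rcases huv with h | h
    · obtain ⟨t', -, h₁, h₂, -⟩ := hcommon u v h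
      exact ⟨t', h₁, h₂⟩
    · obtain ⟨t', h₂, -, -, h₁⟩ := hcommon v u h
      exact ⟨t', h₁, h₂⟩
  exact hpeb u θ hul (hvl.trans (h₂.trans h₁))

/-! ### Existence, trivial bounds and the conclusion -/

lemma simpleWidths_nonempty (σ : DyckWord) : σ.simpleWidths.Nonempty := by
  have := Fintype.ofFinite σ.forest.Node
  obtain ⟨p, hp, -⟩ := exists_isSimpleRepairing σ (Finset.nodup_toList Finset.univ) (by simp)
  exact ⟨_, p, hp, rfl⟩

lemma IsRepairing.one_le_width {σ : DyckWord} (hσ : σ ≠ 0) {p : List (ℕ × ℕ)}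
    (hp : σ.IsRepairing p) : 1 ≤ Repairing.width p := by
  have hlen : 0 < σ.toList.length := List.length_pos_iff.2 (toList_ne_nil.2 hσ)
  obtain ⟨k, hk, -⟩ := hp.exactly_one 0 hlen
  have hmem : 0 ∈ Repairing.erased p p.length := ⟨p.get k, by simp, hk.imp Eq.symm Eq.symm⟩
  refine le_trans ?_ (Repairing.setWidth_erased_le_width p le_rfl)
  obtain ⟨I, hI⟩ := Repairing.exists_intervals_setWidth (Repairing.finite_erased p p.length)
  rw [← hI] at hmem
  obtain ⟨m, -⟩ := Set.mem_iUnion.1 hmem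
  exact Nat.one_le_of_lt m.2

lemma width_eq_zero_of_isRepairing_zero {p : List (ℕ × ℕ)} (hp : IsRepairing 0 p) :
    Repairing.width p = 0 := by
  have : p = [] := List.eq_nil_of_length_eq_zero (by simpa using hp.length_eq)
  subst this
  have hempty : Repairing.erased [] 0 = ∅ := by simp [Repairing.erased]
  have := Repairing.setWidth_le_ncard (Set.finite_empty (α := ℕ))
  simp only [Set.mem_empty_iff_false, false_and, Set.ofPred_false, Set.ncard_empty] at this
  simpa [Repairing.width, hempty] using this

lemma zero_mem_sufficientPebbles : 0 ∈ sufficientPebbles (forest 0).graph := by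
  have hempty : ∀ v : (forest 0).Node, False := by
    rintro ⟨_ | ⟨i, _ | ⟨j, a⟩⟩, h⟩ <;> simp [subtreeAt] at h
  exact ⟨[fun _ => none], ⟨rfl, List.isChain_singleton _⟩,
    ⟨_, List.mem_singleton_self _, fun v => (hempty v).elim, fun v => (hempty v).elim⟩,
    by simp [Config.numPebbles]⟩

lemma one_le_of_mem_sufficientPebbles {σ : DyckWord} (hσ : σ ≠ 0) {k : ℕ}
    (hk : k ∈ sufficientPebbles σ.forest.graph) : 1 ≤ k := by
  obtain ⟨s, -, ⟨c, hc, hgoal⟩, hbound⟩ := hk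
  refine le_trans ?_ (hbound c hc)
  have hroot : (σ.forest.subtreeAt [0]).isSome := by
    rw [← nest_insidePart_add_outsidePart hσ, forest_nest_add]
    simp [subtreeAt]
  refine (Set.ncard_pos (Set.toFinite _)).2 ⟨⟨[0], hroot⟩, hgoal.1 _ ?_⟩
  rintro u ⟨i, hi⟩
  have := congrArg List.length hi
  exact u.ne_nil (List.eq_nil_of_length_eq_zero (by simpa using this.symm))

end DyckWord

theorem mainTheorem7 :
    ∃ c C : ℝ, 0 < c ∧ 0 < C ∧
      ∀ σ : DyckWord, σ.forest.IsTree → σ.forest.IsBinary →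
        σ.simpleWidths.Nonempty ∧
        (Pebbling.sufficientPebbles σ.forest.graph).Nonempty ∧
        c * (Pebbling.bw σ.forest.graph : ℝ) ≤ (σ.minSimpleWidth : ℝ) ∧
        (σ.minSimpleWidth : ℝ) ≤ C * (Pebbling.bw σ.forest.graph : ℝ) := by
  -- The constants come from `6 * w + 2 ≤ 8 * w` and `6 * k + 1 ≤ 7 * k` for `w` and `k` at least 1;
  -- for the empty word both numbers are 0.
  refine ⟨1 / 8, 7, by norm_num, by norm_num, fun σ htree hbin => ?_⟩
  have hne := σ.simpleWidths_nonempty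
  obtain ⟨p, hp, hpw⟩ : σ.minSimpleWidth ∈ σ.simpleWidths := Nat.sInf_mem hne
  have hsuff := hp.mem_sufficientPebbles htree hbin
  have hbw : Pebbling.bw σ.forest.graph ∈ Pebbling.sufficientPebbles σ.forest.graph :=
    Nat.sInf_mem ⟨_, hsuff⟩
  refine ⟨hne, ⟨_, hsuff⟩, ?_⟩
  have key : Pebbling.bw σ.forest.graph ≤ 8 * σ.minSimpleWidth ∧
      σ.minSimpleWidth ≤ 7 * Pebbling.bw σ.forest.graph := by
    rcases eq_or_ne σ 0 with rfl | hσ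
    · have h₁ : Pebbling.bw (DyckWord.forest 0).graph = 0 :=
        Nat.le_zero.1 (Nat.sInf_le DyckWord.zero_mem_sufficientPebbles)
      rw [← hpw, DyckWord.width_eq_zero_of_isRepairing_zero hp.toIsRepairing, h₁]
      simp
    · have h₁ : Pebbling.bw σ.forest.graph ≤ 6 * Repairing.width p + 2 := Nat.sInf_le hsuff
      have h₂ := hp.toIsRepairing.one_le_width hσ
      have h₃ := DyckWord.one_le_of_mem_sufficientPebbles hσ hbw
      obtain ⟨p', hp', hw'⟩ :=
        DyckWord.exists_isSimpleRepairing_of_sufficientPebbles htree hbin hbw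
      have h₄ : σ.minSimpleWidth ≤ Repairing.width p' := Nat.sInf_le ⟨p', hp', rfl⟩
      omega
  have h₁ : (Pebbling.bw σ.forest.graph : ℝ) ≤ 8 * σ.minSimpleWidth := by exact_mod_cast key.1
  have h₂ : (σ.minSimpleWidth : ℝ) ≤ 7 * Pebbling.bw σ.forest.graph := by exact_mod_cast key.2
  exact ⟨by linarith, h₂⟩
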